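/- Let $R$ be a commutative ring. Let $\mathcal R$ be the functor of rings $S\mapsto S$ on the category of commutative $R$-algebras. A functor of $\mathcal R$-modules $\mathbb M$ is a covariant functor on commutative $R$-algebras with an $S$-module structure on each $\mathbb M(S)$, functorial in $S$; morphisms are natural families of $S$-linear maps, and $\mathrm{Hom}_{\mathcal R}(\mathbb M,\mathbb N)$ denotes the set of them. Inclusions, isomorphisms, direct sums, products and tensor products are taken objectwise, so $(\mathbb M\otimes\mathbb N)(S)=\mathbb M(S)\otimes_S\mathbb N(S)$. The dual $\mathbb M^*$ is the functor $S\mapsto \mathrm{Hom}_{\mathcal S}(\mathbb M_{|S},\mathcal R_{|S})$, where $_{|S}$ denotes restriction to commutative $S$-algebras. A functor of $\mathcal R$-modules is dual if it is isomorphic to $\mathbb N^*$ for some functor of $\mathcal R$-modules $\mathbb N$, and reflexive if the canonical morphism $\mathbb M\to\mathbb M^{**}$, $m\mapsto(w\mapsto w(m))$, is an isomorphism. Let $\mathfrak F$ be the family of dual functors of $\mathcal R$-modules $\mathbb M$ for which there exist a set $J$, a structure of functor of $\prod_J\mathcal R$-modules on $\mathbb M$ (extending its $\mathcal R$-module structure,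 where $\prod_J\mathcal R$ has componentwise multiplication), and inclusions of functors of $\prod_J\mathcal R$-modules $$\bigoplus_J\mathcal R\subseteq\mathbb M\subseteq\prod_J\mathcal R$$ whose composite is the obvious inclusion. **Theorem.** If $\mathbb M,\mathbb M'\in\mathfrak F$, then $(\mathbb M'\otimes\mathbb M)^{**}\in\mathfrak F$, and it is the closure of $\mathbb M'\otimes\mathbb M$ in dual functors of $\mathcal R$-modules: for every dual functor of $\mathcal R$-modules $\mathbb M''$, and in particular for every reflexive one, composition with the canonical morphism $\mathbb M'\otimes\mathbb M\to(\mathbb M'\otimes\mathbb M)^{**}$ is a bijection $$\mathrm{Hom}_{\mathcal R}\big((\mathbb M'\otimes\mathbb M)^{**},\mathbb M''\big)\;\longrightarrow\;\mathrm{Hom}_{\mathcal R}(\mathbb M'\otimes\mathbb M,\mathbb M'').$$ -/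

import Mathlib

open scoped TensorProduct

universe u v v' v'' w

/-- A (covariant) functor of modules over the functor of rings `S ↦ S`, on the category of
commutative `R`-algebras: an `S`-module `obj S` for every commutative `R`-algebra `S`, and a
functorial `f`-semilinear map `obj S → obj T` for every morphism of `R`-algebras `f : S → T`. -/
structure ModuleFunctor (R : Type u) [CommRing R] where
  obj : ∀ (S : Type u) [CommRing S] [Algebra R S], Type v
  addCommGroup : ∀ (S : Type u) [CommRing S] [Algebra R S], AddCommGroup (obj S)
  module : ∀ (S : Type u) [CommRing S] [Algebra R S], Module S (obj S)
  map : ∀ {S T : Type u} [CommRing S] [Algebra R S] [CommRing T] [Algebra R T]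
    (f : S →ₐ[R] T), obj S →ₛₗ[(f : S →+* T)] obj T
  map_id : ∀ {S : Type u} [CommRing S] [Algebra R S] (m : obj S), map (AlgHom.id R S) m = m
  map_comp : ∀ {S T U : Type u} [CommRing S] [Algebra R S] [CommRing T] [Algebra R T]
    [CommRing U] [Algebra R U] (g : T →ₐ[R] U) (f : S →ₐ[R] T) (m : obj S),
    map (g.comp f) m = map g (map f m)

namespace ModuleFunctor

attribute [instance] ModuleFunctor.addCommGroup ModuleFunctor.module

variable {R : Type u} [CommRing R]

/-- A morphism of functors of modules: a natural family of `S`-linear maps. -/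
@[ext]
structure Hom (M : ModuleFunctor.{u, v} R) (N : ModuleFunctor.{u, v'} R) where
  app : ∀ (S : Type u) [CommRing S] [Algebra R S], M.obj S →ₗ[S] N.obj S
  naturality : ∀ {S T : Type u} [CommRing S] [Algebra R S] [CommRing T] [Algebra R T]
    (f : S →ₐ[R] T) (m : M.obj S), app T (M.map f m) = N.map f (app S m)

/-- Composition: first `f`, then `g`. -/
def Hom.comp {M : ModuleFunctor.{u, v} R} {N : ModuleFunctor.{u, v'} R}
    {P : ModuleFunctor.{u, v''} R} (g : Hom N P) (f : Hom M N) : Hom M P where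
  app S _ _ := (g.app S) ∘ₗ (f.app S)
  naturality h m := by simp [f.naturality, g.naturality]

/-- An injective morphism (an inclusion of functors, up to isomorphism). -/
def Hom.IsInjective {M : ModuleFunctor.{u, v} R} {N : ModuleFunctor.{u, v'} R}
    (f : Hom M N) : Prop :=
  ∀ (S : Type u) [CommRing S] [Algebra R S], Function.Injective (f.app S)

/-- An isomorphism of functors of modules. -/
def Hom.IsIso {M : ModuleFunctor.{u, v} R} {N : ModuleFunctor.{u, v'} R}
    (f : Hom M N) : Prop :=
  ∀ (S : Type u) [CommRing S] [Algebra R S], Function.Bijective (f.app S)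

/-- The set of morphisms `M|_S → N|_S` of functors on commutative `S`-algebras. A commutative
`S`-algebra is given here as a commutative `R`-algebra `T` with a morphism `g : S → T` of
`R`-algebras, and a morphism of `S`-algebras `(T, g) → (T', g')` as a morphism `h : T → T'` of
`R`-algebras such that `g' = h ∘ g`. -/
@[ext]
structure RestrictedHom (M : ModuleFunctor.{u, v} R) (N : ModuleFunctor.{u, v'} R)
    (S : Type u) [CommRing S] [Algebra R S] where
  app : ∀ (T : Type u) [CommRing T] [Algebra R T] (_g : S →ₐ[R] T), M.obj T →ₗ[T] N.obj T
  naturality : ∀ {T T' : Type u} [CommRing T] [Algebra R T] [CommRing T'] [Algebra R T']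
    (g : S →ₐ[R] T) (h : T →ₐ[R] T') (m : M.obj T),
    app T' (h.comp g) (M.map h m) = N.map h (app T g m)

namespace RestrictedHom

variable {M : ModuleFunctor.{u, v} R} {N : ModuleFunctor.{u, v'} R}
  {S : Type u} [CommRing S] [Algebra R S]

instance : Zero (RestrictedHom M N S) :=
  ⟨{ app := fun _ _ _ _ => 0, naturality := by simp }⟩

instance : Add (RestrictedHom M N S) :=
  ⟨fun φ ψ =>
    { app := fun T _ _ g => φ.app T g + ψ.app T g
      naturality := fun g h m => by simp [φ.naturality, ψ.naturality] }⟩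

instance : Neg (RestrictedHom M N S) :=
  ⟨fun φ =>
    { app := fun T _ _ g => -φ.app T g
      naturality := fun g h m => by simp [φ.naturality] }⟩

instance : SMul S (RestrictedHom M N S) :=
  ⟨fun s φ =>
    { app := fun T _ _ g => g s • φ.app T g
      naturality := fun g h m => by simp [φ.naturality] }⟩

@[simp] theorem zero_app (T : Type u) [CommRing T] [Algebra R T] (g : S →ₐ[R] T) :
    (0 : RestrictedHom M N S).app T g = 0 := rfl

@[simp] theorem add_app (φ ψ : RestrictedHom M N S) (T : Type u) [CommRing T] [Algebra R T]
    (g : S →ₐ[R] T) : (φ + ψ).app T g = φ.app T g + ψ.app T g := rfl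

@[simp] theorem neg_app (φ : RestrictedHom M N S) (T : Type u) [CommRing T] [Algebra R T]
    (g : S →ₐ[R] T) : (-φ).app T g = -φ.app T g := rfl

@[simp] theorem smul_app (s : S) (φ : RestrictedHom M N S) (T : Type u) [CommRing T]
    [Algebra R T] (g : S →ₐ[R] T) : (s • φ).app T g = g s • φ.app T g := rfl

instance : AddCommGroup (RestrictedHom M N S) where
  add_assoc a b c := by ext; simp [add_assoc]
  zero_add a := by ext; simp
  add_zero a := by ext; simp
  neg_add_cancel a := by ext; simp
  add_comm a b := by ext; simp [add_comm]
  nsmul := nsmulRec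
  zsmul := zsmulRec

instance : Module S (RestrictedHom M N S) where
  one_smul a := by ext; simp
  mul_smul s t a := by ext; simp [mul_smul]
  smul_zero s := by ext; simp
  smul_add s a b := by ext; simp
  add_smul s t a := by ext; simp [add_smul]
  zero_smul a := by ext; simp

end RestrictedHom

/-- The functor of morphisms, `S ↦ Hom_S(M|_S, N|_S)`. -/
def internalHom (M : ModuleFunctor.{u, v} R) (N : ModuleFunctor.{u, v'} R) :
    ModuleFunctor.{u, max (u + 1) v v'} R where
  obj S _ _ := RestrictedHom M N S
  addCommGroup _ _ _ := inferInstance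
  module _ _ _ := inferInstance
  map f :=
    { toFun := fun φ =>
        { app := fun T _ _ g => φ.app T (g.comp f)
          naturality := fun g h m => φ.naturality (g.comp f) h m }
      map_add' := fun _ _ => rfl
      map_smul' := fun _ _ => rfl }
  map_id _ := rfl
  map_comp _ _ _ := rfl

/-- The functor `S ↦ S`. -/
def structureFunctor (R : Type u) [CommRing R] : ModuleFunctor.{u, u} R where
  obj S _ _ := S
  addCommGroup _ _ _ := inferInstance
  module _ _ _ := inferInstance
  map f := { toFun := f, map_add' := by simp, map_smul' := by simp }
  map_id _ := rfl
  map_comp _ _ _ := rfl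

/-- The dual functor `M^*`. -/
def dual (M : ModuleFunctor.{u, v} R) : ModuleFunctor.{u, max (u + 1) v} R :=
  internalHom M (structureFunctor R)

/-- The canonical morphism `M → M^{**}`, `m ↦ (w ↦ w(m))`. -/
def toBidual (M : ModuleFunctor.{u, v} R) : Hom M M.dual.dual where
  app S _ _ :=
    { toFun := fun m =>
        { app := fun T _ _ g =>
            { toFun := fun (w : RestrictedHom M (structureFunctor R) T) =>
                w.app T (AlgHom.id R T) (M.map g m)
              map_add' := fun _ _ => rfl
              map_smul' := fun _ _ => rfl }
          naturality := fun {T T' _ _ _ _} g h w => by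
            change RestrictedHom M (structureFunctor R) T at w
            change w.app T' ((AlgHom.id R T').comp h) (M.map (h.comp g) m) = _
            rw [M.map_comp]
            exact w.naturality (AlgHom.id R T) h (M.map g m) }
      map_add' := fun m m' => by
        refine RestrictedHom.ext ?_
        funext T _ _ g
        refine LinearMap.ext fun (w : RestrictedHom M (structureFunctor R) T) => ?_
        change w.app T (AlgHom.id R T) (M.map g (m + m')) =
          w.app T (AlgHom.id R T) (M.map g m) + w.app T (AlgHom.id R T) (M.map g m')
        rw [map_add, map_add]
      map_smul' := fun s m => by
        refine RestrictedHom.ext ?_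
        funext T _ _ g
        refine LinearMap.ext fun (w : RestrictedHom M (structureFunctor R) T) => ?_
        change w.app T (AlgHom.id R T) (M.map g (s • m)) =
          g s • w.app T (AlgHom.id R T) (M.map g m)
        rw [LinearMap.map_smulₛₗ, map_smul]
        rfl }
  naturality {S S' _ _ _ _} f m := by
    refine RestrictedHom.ext ?_
    funext T _ _ g
    refine LinearMap.ext fun (w : RestrictedHom M (structureFunctor R) T) => ?_
    change w.app T (AlgHom.id R T) (M.map g (M.map f m)) =
      w.app T (AlgHom.id R T) (M.map (g.comp f) m)
    rw [M.map_comp]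

/-- `M` is a dual functor: it is isomorphic to `N^*` for some functor of modules `N`
(with values in the universe `w`). -/
def IsDual (M : ModuleFunctor.{u, v} R) : Prop :=
  ∃ (N : ModuleFunctor.{u, w} R) (f : Hom M N.dual), f.IsIso

/-- `M` is reflexive: the canonical morphism `M → M^{**}` is an isomorphism. -/
def IsReflexive (M : ModuleFunctor.{u, v} R) : Prop :=
  M.toBidual.IsIso

/-- The tensor product, `S ↦ M(S) ⊗_S N(S)`. -/
noncomputable def tensor (M : ModuleFunctor.{u, v} R) (N : ModuleFunctor.{u, v'} R) :
    ModuleFunctor.{u, max v v'} R where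
  obj S _ _ := M.obj S ⊗[S] N.obj S
  addCommGroup _ _ _ := inferInstance
  module _ _ _ := inferInstance
  map f := TensorProduct.map (M.map f) (N.map f)
  map_id x := by
    induction x with
    | zero => exact map_zero _
    | tmul m n => exact (TensorProduct.map_tmul _ _ m n).trans (by rw [M.map_id, N.map_id])
    | add x y hx hy => exact (map_add _ x y).trans (by rw [hx, hy])
  map_comp g f x := by
    induction x with
    | zero => simp
    | tmul m n => simp [M.map_comp, N.map_comp]
    | add x y hx hy => rw [map_add, hx, hy, map_add, map_add]

/-- The product `∏_J 𝓡`, `S ↦ ∏_J S`. -/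
def prod (R : Type u) [CommRing R] (J : Type u) : ModuleFunctor.{u, u} R where
  obj S _ _ := J → S
  addCommGroup _ _ _ := inferInstance
  module _ _ _ := inferInstance
  map f :=
    { toFun := fun a j => f (a j)
      map_add' := fun a b => by funext j; simp
      map_smul' := fun s a => by funext j; simp }
  map_id _ := rfl
  map_comp _ _ _ := rfl

/-- The direct sum `⊕_J 𝓡`, `S ↦ ⊕_J S`, as finitely supported families. -/
noncomputable def directSum (R : Type u) [CommRing R] (J : Type u) : ModuleFunctor.{u, u} R where
  obj S _ _ := J →₀ S
  addCommGroup _ _ _ := inferInstance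
  module _ _ _ := inferInstance
  map f :=
    { toFun := fun a => a.mapRange f (map_zero f)
      map_add' := fun a b => by ext j; simp
      map_smul' := fun s a => by ext j; simp }
  map_id a := Finsupp.ext fun j => rfl
  map_comp g f a := by ext j; simp

/-- The obvious inclusion `⊕_J 𝓡 ⊆ ∏_J 𝓡`. -/
noncomputable def directSumToProd (R : Type u) [CommRing R] (J : Type u) :
    Hom (directSum R J) (prod R J) where
  app S _ _ :=
    { toFun := fun (a : J →₀ S) => (a : J → S)
      map_add' := fun _ _ => rfl
      map_smul' := fun _ _ => rfl }
  naturality _ _ := rfl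

/-- A structure of functor of `∏_J 𝓡`-modules on the functor of modules `M`, where `∏_J 𝓡` is the
functor of algebras with componentwise multiplication: for every `S`, a structure of `∏_J S`-module
on `M(S)` extending its structure of `S`-module, functorially in `S`. -/
structure ProdModuleStructure (J : Type u) (M : ModuleFunctor.{u, v} R) where
  act : ∀ (S : Type u) [CommRing S] [Algebra R S], (J → S) →ₐ[S] Module.End S (M.obj S)
  map_act : ∀ {S T : Type u} [CommRing S] [Algebra R S] [CommRing T] [Algebra R T]
    (f : S →ₐ[R] T) (a : J → S) (m : M.obj S),
    M.map f (act S a m) = act T (fun j => f (a j)) (M.map f m)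

/-- The componentwise structure of functor of `∏_J 𝓡`-modules on `∏_J 𝓡`. -/
def prodStructure (R : Type u) [CommRing R] (J : Type u) : ProdModuleStructure J (prod R J) where
  act S _ _ := Algebra.lmul S (J → S)
  map_act f a b := by
    funext j
    exact map_mul f (a j) (b j)

/-- The componentwise structure of functor of `∏_J 𝓡`-modules on `⊕_J 𝓡`. -/
noncomputable def directSumStructure (R : Type u) [CommRing R] (J : Type u) :
    ProdModuleStructure J (directSum R J) where
  act S _ _ := AlgHom.ofLinearMap
    { toFun := fun a =>
        { toFun := fun (b : J →₀ S) => a • b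
          map_add' := fun (b c : J →₀ S) => smul_add a b c
          map_smul' := fun s (b : J →₀ S) => Finsupp.ext fun j => mul_left_comm (a j) s (b j) }
      map_add' := fun a a' => LinearMap.ext fun (b : J →₀ S) => add_smul a a' b
      map_smul' := fun s a => LinearMap.ext fun (b : J →₀ S) =>
        Finsupp.ext fun j => mul_assoc s (a j) (b j) }
    (LinearMap.ext fun (b : J →₀ S) => one_smul (J → S) b)
    (fun a a' => LinearMap.ext fun (b : J →₀ S) => mul_smul a a' b)
  map_act {S T _ _ _ _} f a b := by
    refine Finsupp.ext fun j => ?_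
    change J →₀ S at b
    exact map_mul f (a j) (b j)

/-- A morphism of functors of `∏_J 𝓡`-modules. -/
def Hom.IsProdLinear {J : Type u} {M : ModuleFunctor.{u, v} R} {N : ModuleFunctor.{u, v'} R}
    (A : ProdModuleStructure J M) (B : ProdModuleStructure J N) (f : Hom M N) : Prop :=
  ∀ (S : Type u) [CommRing S] [Algebra R S] (a : J → S) (m : M.obj S),
    f.app S (A.act S a m) = B.act S a (f.app S m)

/-- The family `𝔉`: the dual functors `M` which, for some set `J`, carry a structure of functor of
`∏_J 𝓡`-modules and inclusions `⊕_J 𝓡 ⊆ M ⊆ ∏_J 𝓡` of functors of `∏_J 𝓡`-modules whose composite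
is the obvious inclusion. Here `M ≅ N^*` for a functor `N` with values in the same universe `u` as
the commutative `R`-algebras, and `J` is a set of that universe. -/
def InF (M : ModuleFunctor.{u, v} R) : Prop :=
  IsDual.{u, v, u} M ∧
    ∃ (J : Type u) (A : ProdModuleStructure J M)
      (i : Hom (directSum R J) M) (p : Hom M (prod R J)),
      i.IsInjective ∧ i.IsProdLinear (directSumStructure R J) A ∧
      p.IsInjective ∧ p.IsProdLinear A (prodStructure R J) ∧
      p.comp i = directSumToProd R J

end ModuleFunctor

/-! Everything rests on a finiteness principle: a natural map ∏_K 𝓡 → 𝓡 is a polynomial, so it sees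
only finitely many coordinates (`exists_finset_congr`). When ∏_K 𝓡 acts on a functor lying between
⊕_K 𝓡 and ∏_K 𝓡, applying this to a ↦ w(a·x) for a functional w shows that w(x) is a finite sum of
terms x_k w(e_k). `CoordinateSystem` isolates this property without asking the coordinate map `p` to
be injective. For M' ⊗ M both factors are scaled independently, which gives a coordinate system
indexed by J' × J (`tensorCoordinateSystem`). The property passes from X to X^*, with vectors and
coordinates exchanging roles (`CoordinateSystem.dual`). On a dual the coordinates are injective,
because a functional is determined by its values at the e_k. Hence X^{**} lies between ⊕_K 𝓡 and ∏_K
𝓡, and so is in 𝔉 (`inF_dual_dual`). For the closure property, a morphism X → N^* amounts to a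
morphism N → X^*, whose transpose is an extension X^{**} → N^*. The extension is unique because the
basis vectors of X^{**} are the images of those of X, so a functional on X^{**} is determined by its
restriction to X (`dual_ext_toBidual`). -/

namespace ModuleFunctor

variable {R : Type u} [CommRing R]

/-! ### Natural maps on a product are polynomials. -/

/-- A natural map `∏_K 𝓡 → 𝓡` of functors of sets on commutative `S`-algebras depends only on
finitely many coordinates: it is given by a polynomial, its value at the universal point. -/
theorem exists_finset_congr {S : Type u} [CommRing S] [Algebra R S] {K : Type u}
    (f : ∀ (T : Type u) [CommRing T] [Algebra R T] (_ : S →ₐ[R] T), (K → T) → T)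
    (hf : ∀ {T T' : Type u} [CommRing T] [Algebra R T] [CommRing T'] [Algebra R T']
      (g : S →ₐ[R] T) (h : T →ₐ[R] T') (a : K → T),
      f T' (h.comp g) (fun k => h (a k)) = h (f T g a)) :
    ∃ V : Finset K, ∀ (T : Type u) [CommRing T] [Algebra R T] (g : S →ₐ[R] T) (a b : K → T),
      (∀ k ∈ V, a k = b k) → f T g a = f T g b := by
  classical
  let ι : S →ₐ[R] MvPolynomial K S := IsScalarTower.toAlgHom R S _
  let q := f _ ι MvPolynomial.X
  have key : ∀ (T : Type u) [CommRing T] [Algebra R T] (g : S →ₐ[R] T) (a : K → T),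
      f T g a = MvPolynomial.eval₂Hom (g : S →+* T) a q := by
    intro T _ _ g a
    -- Evaluation at `a` carries the universal point to `a`, so naturality along it computes `f` at
    -- `a` from `q`. Having `K` in universe `u` makes the polynomial ring an admissible test
    -- algebra.
    let ev : MvPolynomial K S →ₐ[R] T :=
      { MvPolynomial.eval₂Hom (g : S →+* T) a with
        commutes' := fun r => by
          rw [IsScalarTower.algebraMap_apply R S (MvPolynomial K S)]
          simp [MvPolynomial.algebraMap_eq] }
    have h1 : ev.comp ι = g := by
      ext s
      simp [ev, ι, MvPolynomial.algebraMap_eq]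
    have h2 : (fun k => ev (MvPolynomial.X k)) = a := by
      funext k
      simp [ev]
    have h := hf ι ev MvPolynomial.X
    rw [h1, h2] at h
    exact h
  refine ⟨q.vars, fun T _ _ g a b hab => ?_⟩
  rw [key, key]
  exact MvPolynomial.eval₂Hom_congr' rfl (fun k hk _ => hab k hk) rfl

/-! ### Evaluation of functionals. -/

section Pairing

variable (X : ModuleFunctor.{u, v} R)

/-- The evaluation of functionals, `X^*(S) × X(S) → S`. -/
def pairing (S : Type u) [CommRing S] [Algebra R S] :
    X.dual.obj S →ₗ[S] X.obj S →ₗ[S] S where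
  toFun := fun (w : RestrictedHom X (structureFunctor R) S) => w.app S (AlgHom.id R S)
  map_add' _ _ := rfl
  map_smul' _ _ := rfl

variable {X} {S T : Type u} [CommRing S] [Algebra R S] [CommRing T] [Algebra R T]

theorem pairing_map (f : S →ₐ[R] T) (w : X.dual.obj S) (x : X.obj S) :
    X.pairing T (X.dual.map f w) (X.map f x) = f (X.pairing S w x) :=
  RestrictedHom.naturality (M := X) (N := structureFunctor R) w (AlgHom.id R S) f x

theorem dual_ext {w w' : X.dual.obj S}
    (h : ∀ (T : Type u) [CommRing T] [Algebra R T] (g : S →ₐ[R] T) (x : X.obj T),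
      X.pairing T (X.dual.map g w) x = X.pairing T (X.dual.map g w') x) : w = w' := by
  refine RestrictedHom.ext ?_
  funext T _ _ g
  exact LinearMap.ext (h T g)

theorem exists_dual (f : ∀ (T : Type u) [CommRing T] [Algebra R T] (_ : S →ₐ[R] T),
      X.obj T →ₗ[T] T)
    (hf : ∀ {T T' : Type u} [CommRing T] [Algebra R T] [CommRing T'] [Algebra R T']
      (g : S →ₐ[R] T) (h : T →ₐ[R] T') (x : X.obj T),
      f T' (h.comp g) (X.map h x) = h (f T g x)) :
    ∃ w : X.dual.obj S, ∀ (T : Type u) [CommRing T] [Algebra R T] (g : S →ₐ[R] T) (x : X.obj T),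
      X.pairing T (X.dual.map g w) x = f T g x :=
  ⟨(⟨f, hf⟩ : RestrictedHom X (structureFunctor R) S), fun _ _ _ _ _ => rfl⟩

@[simp] theorem pairing_toBidual (x : X.obj S) (w : X.dual.obj S) :
    X.dual.pairing S (X.toBidual.app S x) w = X.pairing S w x := by
  change X.pairing S w (X.map (AlgHom.id R S) x) = _
  rw [X.map_id]

end Pairing

/-! ### Coordinate systems and their duals. -/

/-- Elements `e k` of `X` and a morphism `p : X → ∏_K 𝓡` dual to them, such that the value of every
functional `w` at `x` is the finite sum of the `p(x)_k w(e_k)`. -/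
structure CoordinateSystem (K : Type u) (X : ModuleFunctor.{u, v} R) where
  e : ∀ (S : Type u) [CommRing S] [Algebra R S], K → X.obj S
  map_e : ∀ {S T : Type u} [CommRing S] [Algebra R S] [CommRing T] [Algebra R T]
    (f : S →ₐ[R] T) (k : K), X.map f (e S k) = e T k
  p : ∀ (S : Type u) [CommRing S] [Algebra R S], X.obj S →ₗ[S] (K → S)
  p_map : ∀ {S T : Type u} [CommRing S] [Algebra R S] [CommRing T] [Algebra R T]
    (f : S →ₐ[R] T) (x : X.obj S) (k : K), p T (X.map f x) k = f (p S x k)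
  p_e_self : ∀ (S : Type u) [CommRing S] [Algebra R S] (k : K), p S (e S k) k = 1
  p_e_ne : ∀ (S : Type u) [CommRing S] [Algebra R S] (k l : K), k ≠ l → p S (e S k) l = 0
  finite_support : ∀ (S : Type u) [CommRing S] [Algebra R S] (w : X.dual.obj S) (x : X.obj S),
    (Function.support fun k => p S x k * X.pairing S w (e S k)).Finite
  pairing_eq : ∀ (S : Type u) [CommRing S] [Algebra R S] (w : X.dual.obj S) (x : X.obj S),
    X.pairing S w x = ∑ᶠ k, p S x k * X.pairing S w (e S k)

namespace CoordinateSystem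

variable {K : Type u} {X : ModuleFunctor.{u, v} R} (C : CoordinateSystem K X)
  {S T : Type u} [CommRing S] [Algebra R S] [CommRing T] [Algebra R T]

/-- The morphism `X → ∏_K 𝓡` of a coordinate system. -/
def toProd : Hom X (prod R K) where
  app S _ _ := C.p S
  naturality f x := funext fun k => C.p_map f x k

/-- The morphism `⊕_K 𝓡 → X` of a coordinate system. -/
noncomputable def ofDirectSum : Hom (directSum R K) X where
  app S _ _ := Finsupp.linearCombination S (C.e S)
  naturality {S T _ _ _ _} f x := by
    change K →₀ S at x
    change Finsupp.linearCombination T (C.e T) (x.mapRange f (map_zero f)) =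
      X.map f (Finsupp.linearCombination S (C.e S) x)
    induction x using Finsupp.induction_linear with
    | zero => simp
    | add x y hx hy => rw [Finsupp.mapRange_add (map_add f), map_add, map_add, map_add, hx, hy]
    | single k s =>
      rw [Finsupp.mapRange_single, Finsupp.linearCombination_single,
        Finsupp.linearCombination_single, LinearMap.map_smulₛₗ, C.map_e]
      rfl

theorem p_e [DecidableEq K] (k : K) : C.p S (C.e S k) = Pi.single k 1 := by
  funext l
  by_cases h : k = l
  · subst h
    rw [C.p_e_self, Pi.single_eq_same]
  · rw [C.p_e_ne S k l h, Pi.single_eq_of_ne (Ne.symm h)]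

theorem toProd_comp_ofDirectSum : C.toProd.comp C.ofDirectSum = directSumToProd R K := by
  classical
  refine Hom.ext ?_
  funext S _ _
  refine LinearMap.ext fun x => ?_
  change K →₀ S at x
  change C.p S (Finsupp.linearCombination S (C.e S) x) = x
  induction x using Finsupp.induction_linear with
  | zero => rw [map_zero, map_zero]; rfl
  | add x y hx hy => rw [map_add, map_add, hx, hy]; rfl
  | single k s =>
    rw [Finsupp.linearCombination_single, map_smul, C.p_e, Finsupp.single_eq_pi_single,
      ← Pi.single_smul, smul_eq_mul, mul_one]

/-- A functional is zero if it vanishes on the elements `e k`. -/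
theorem dual_ext_e {w w' : X.dual.obj S}
    (h : ∀ k, X.pairing S w (C.e S k) = X.pairing S w' (C.e S k)) : w = w' := by
  refine dual_ext fun T _ _ g x => ?_
  rw [C.pairing_eq, C.pairing_eq]
  refine finsum_congr fun k => ?_
  rw [← C.map_e g, pairing_map, pairing_map, h]

/-- The componentwise action of `∏_K S` on functionals. -/
theorem exists_mul (a : K → S) (w : X.dual.obj S) :
    ∃ w' : X.dual.obj S, ∀ k, X.pairing S w' (C.e S k) = a k * X.pairing S w (C.e S k) := by
  have fin : ∀ (T : Type u) [CommRing T] [Algebra R T] (g : S →ₐ[R] T) (x : X.obj T),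
      (Function.support fun k =>
        g (a k) * (C.p T x k * X.pairing T (X.dual.map g w) (C.e T k))).Finite :=
    fun T _ _ g x => (C.finite_support T (X.dual.map g w) x).subset
      fun k hk h => hk (by simp only [h, mul_zero])
  -- The expansion of w is scaled term by term: w'(x) = Σ a_k p(x)_k w(e_k), over every S-algebra.
  obtain ⟨w', hw'⟩ := exists_dual (X := X) (S := S)
    (fun T _ _ g =>
      { toFun := fun x =>
          ∑ᶠ k, g (a k) * (C.p T x k * X.pairing T (X.dual.map g w) (C.e T k))
        map_add' := fun x y => by
          rw [← finsum_add_distrib (fin T g x) (fin T g y)]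
          refine finsum_congr fun k => ?_
          rw [map_add, Pi.add_apply]
          ring
        map_smul' := fun t x => by
          rw [RingHom.id_apply, smul_finsum' t (fin T g x)]
          refine finsum_congr fun k => ?_
          rw [map_smul, Pi.smul_apply, smul_eq_mul, smul_eq_mul]
          ring })
    -- The sum has finite support already over `T`, so `h` commutes with it.
    (fun {T T' _ _ _ _} g h x => by
      refine Eq.trans ?_ ((h : T →+* T').toAddMonoidHom.map_finsum (fin T g x)).symm
      refine finsum_congr fun k => ?_
      change h (g (a k)) * _ = h _
      rw [map_mul, map_mul, C.p_map, X.dual.map_comp, ← C.map_e h, pairing_map])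
  refine ⟨w', fun k => ?_⟩
  have h := hw' S (AlgHom.id R S) (C.e S k)
  rw [X.dual.map_id] at h
  rw [h]
  change ∑ᶠ l, a l * (C.p S (C.e S k) l * X.pairing S _ (C.e S l)) = _
  rw [finsum_eq_single _ k, C.p_e_self, one_mul, X.dual.map_id]
  intro l hl
  rw [C.p_e_ne S k l hl.symm, zero_mul, mul_zero]

/-- The `k`-th coordinate, as a functional. -/
theorem exists_coord (S : Type u) [CommRing S] [Algebra R S] (k : K) :
    ∃ w : X.dual.obj S, ∀ (T : Type u) [CommRing T] [Algebra R T] (g : S →ₐ[R] T) (x : X.obj T),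
      X.pairing T (X.dual.map g w) x = C.p T x k :=
  exists_dual (fun T _ _ _ => (LinearMap.proj k : (K → T) →ₗ[T] T) ∘ₗ C.p T)
    (fun _ h x => C.p_map h x k)

/-- The `k`-th coordinate, as a functional. -/
noncomputable def coord (S : Type u) [CommRing S] [Algebra R S] (k : K) : X.dual.obj S :=
  (C.exists_coord S k).choose

@[simp] theorem pairing_coord (k : K) (x : X.obj S) :
    X.pairing S (C.coord S k) x = C.p S x k := by
  have h := (C.exists_coord S k).choose_spec S (AlgHom.id R S) x
  rwa [X.dual.map_id] at h

theorem map_coord (f : S →ₐ[R] T) (k : K) : X.dual.map f (C.coord S k) = C.coord T k := by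
  refine C.dual_ext_e fun l => ?_
  rw [pairing_coord]
  exact (C.exists_coord S k).choose_spec T f _

/-- The product of a functional by an element of `∏_K S`. -/
noncomputable def mul (a : K → S) (w : X.dual.obj S) : X.dual.obj S :=
  (C.exists_mul a w).choose

@[simp] theorem pairing_mul (a : K → S) (w : X.dual.obj S) (k : K) :
    X.pairing S (C.mul a w) (C.e S k) = a k * X.pairing S w (C.e S k) :=
  (C.exists_mul a w).choose_spec k

theorem map_mul (f : S →ₐ[R] T) (a : K → S) (w : X.dual.obj S) :
    X.dual.map f (C.mul a w) = C.mul (fun k => f (a k)) (X.dual.map f w) := by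
  refine C.dual_ext_e fun k => ?_
  rw [pairing_mul, ← C.map_e f, pairing_map, pairing_map, pairing_mul, _root_.map_mul]

/-- The map a ↦ φ(a·w) is natural in a ∈ ∏_K 𝓡, so it depends only on the coordinates in a finite
set V. Comparing a = 1 with the indicator of V gives the sum; comparing δ_k with 0 for k ∉ V shows
that the remaining terms vanish. -/
theorem exists_finset_pairing_eq_sum (φ : X.dual.dual.obj S) (w : X.dual.obj S) :
    ∃ V : Finset K,
      (∀ k ∉ V, X.pairing S w (C.e S k) * X.dual.pairing S φ (C.coord S k) = 0) ∧
      X.dual.pairing S φ w =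
        ∑ k ∈ V, X.pairing S w (C.e S k) * X.dual.pairing S φ (C.coord S k) := by
  classical
  obtain ⟨V, hV⟩ := exists_finset_congr (R := R) (S := S) (K := K)
    (fun T _ _ g a => X.dual.pairing T (X.dual.dual.map g φ) (C.mul a (X.dual.map g w)))
    (fun {T T' _ _ _ _} g h a => by
      rw [X.dual.dual.map_comp, X.dual.map_comp, ← C.map_mul h, pairing_map])
  replace hV : ∀ a b : K → S, (∀ k ∈ V, a k = b k) →
      X.dual.pairing S φ (C.mul a w) = X.dual.pairing S φ (C.mul b w) := by
    intro a b hab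
    have h := hV S (AlgHom.id R S) a b hab
    rwa [X.dual.map_id, X.dual.dual.map_id] at h
  refine ⟨V, fun k hk => ?_, ?_⟩
  · have h1 : C.mul (Pi.single k 1) w = X.pairing S w (C.e S k) • C.coord S k := by
      refine C.dual_ext_e fun l => ?_
      rw [pairing_mul, map_smul, LinearMap.smul_apply, pairing_coord, C.p_e]
      by_cases hl : k = l
      · subst hl
        simp
      · simp [Pi.single_eq_of_ne hl, Pi.single_eq_of_ne (Ne.symm hl)]
    have h2 : C.mul 0 w = 0 := C.dual_ext_e fun l => by simp
    have h := hV (Pi.single k 1) 0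
      fun l hl => Pi.single_eq_of_ne (ne_of_mem_of_not_mem hl hk) 1
    rw [h1, h2, map_smul, map_zero, smul_eq_mul] at h
    exact h
  · have h1 : C.mul 1 w = w := C.dual_ext_e fun l => by simp
    have h2 : C.mul (fun k => if k ∈ V then 1 else 0) w =
        ∑ k ∈ V, X.pairing S w (C.e S k) • C.coord S k := by
      refine C.dual_ext_e fun l => ?_
      rw [pairing_mul, map_sum, LinearMap.sum_apply]
      simp [C.p_e, Pi.single_apply]
    have h := hV 1 (fun k => if k ∈ V then 1 else 0) fun k hk => by simp [hk]
    rw [h1, h2, map_sum] at h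
    rw [h]
    exact Finset.sum_congr rfl fun k _ => by rw [map_smul, smul_eq_mul]

/-- The dual coordinate system. -/
noncomputable def dual : CoordinateSystem K X.dual where
  e S _ _ k := C.coord S k
  map_e f k := C.map_coord f k
  p S _ _ := LinearMap.pi fun k => (X.pairing S).flip (C.e S k)
  p_map f w k := by
    change X.pairing _ (X.dual.map f w) (C.e _ k) = _
    rw [← C.map_e f, pairing_map]
    rfl
  p_e_self S _ _ k := by
    change X.pairing _ (C.coord S k) (C.e S k) = _
    rw [pairing_coord, C.p_e_self]
  p_e_ne S _ _ k l h := by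
    change X.pairing _ (C.coord S k) (C.e S l) = _
    rw [pairing_coord, C.p_e_ne S l k h.symm]
  finite_support S _ _ φ w := by
    obtain ⟨V, hV, -⟩ := C.exists_finset_pairing_eq_sum φ w
    exact V.finite_toSet.subset fun k hk => by_contra fun h => hk (hV k h)
  pairing_eq S _ _ φ w := by
    obtain ⟨V, hV, h⟩ := C.exists_finset_pairing_eq_sum φ w
    rw [h]
    refine (finsum_eq_sum_of_support_subset _ fun k hk => ?_).symm
    exact by_contra fun h => hk (hV k h)

theorem p_dual_injective (S : Type u) [CommRing S] [Algebra R S] :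
    Function.Injective (C.dual.p S) :=
  fun _ _ h => C.dual_ext_e fun k => congrFun h k

theorem p_dual_mul (a : K → S) (w : X.dual.obj S) : C.dual.p S (C.mul a w) = a * C.dual.p S w :=
  funext fun k => C.pairing_mul a w k

/-- The componentwise structure of functor of `∏_K 𝓡`-modules on the dual. -/
noncomputable def prodModuleStructure : ProdModuleStructure K X.dual where
  act S _ _ := AlgHom.ofLinearMap
    { toFun := fun a =>
        { toFun := fun w => C.mul a w
          map_add' := fun w w' => C.p_dual_injective S (by simp only [p_dual_mul, map_add, mul_add])
          map_smul' := fun s w => C.p_dual_injective S (by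
            simp only [p_dual_mul, map_smul, RingHom.id_apply, mul_smul_comm]) }
      map_add' := fun a b => LinearMap.ext fun w => C.p_dual_injective S (by
        change C.dual.p S (C.mul _ w) = C.dual.p S (C.mul a w + C.mul b w)
        simp only [p_dual_mul, map_add, add_mul])
      map_smul' := fun s a => LinearMap.ext fun w => C.p_dual_injective S (by
        change C.dual.p S (C.mul _ w) = C.dual.p S (s • C.mul a w)
        simp only [p_dual_mul, map_smul, smul_mul_assoc]) }
    (LinearMap.ext fun w => C.p_dual_injective S (by
      change C.dual.p S (C.mul 1 w) = C.dual.p S w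
      rw [p_dual_mul, one_mul]))
    (fun a b => LinearMap.ext fun w => C.p_dual_injective S (by
      change C.dual.p S (C.mul (a * b) w) = C.dual.p S (C.mul a (C.mul b w))
      simp only [p_dual_mul, mul_assoc]))
  map_act f a w := C.map_mul f a w

/-- The dual of a functor with a coordinate system lies between `⊕_K 𝓡` and `∏_K 𝓡`. -/
theorem exists_inclusions (C : CoordinateSystem K X) :
    ∃ (J : Type u) (A : ProdModuleStructure J X.dual)
      (i : Hom (directSum R J) X.dual) (p : Hom X.dual (prod R J)),
      i.IsInjective ∧ i.IsProdLinear (directSumStructure R J) A ∧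
      p.IsInjective ∧ p.IsProdLinear A (prodStructure R J) ∧
      p.comp i = directSumToProd R J := by
  have hpi : ∀ (S : Type u) [CommRing S] [Algebra R S] (b : K →₀ S),
      C.dual.p S (C.dual.ofDirectSum.app S b) = b := fun S _ _ b =>
    congrArg (fun f : Hom (directSum R K) (prod R K) => f.app S b) C.dual.toProd_comp_ofDirectSum
  refine ⟨K, C.prodModuleStructure, C.dual.ofDirectSum, C.dual.toProd, ?_, ?_, ?_, ?_,
    C.dual.toProd_comp_ofDirectSum⟩
  · intro S _ _ b b' h
    have h' := congrArg (C.dual.p S) h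
    exact DFunLike.coe_injective (F := K →₀ S) ((hpi S b).symm.trans (h'.trans (hpi S b')))
  · intro S _ _ a b
    -- Injectivity of the coordinates reduces linearity of the inclusion to multiplication of
    -- families.
    refine C.p_dual_injective S ?_
    refine (hpi S _).trans (Eq.trans ?_ (C.p_dual_mul a _).symm)
    exact congrArg (a * ·) (hpi S b).symm
  · exact fun S _ _ => C.p_dual_injective S
  · exact fun S _ _ a w => C.p_dual_mul a w

/-- A functor isomorphic to `X^*`, with values in the universe of the commutative `R`-algebras. -/
noncomputable def smallDual : ModuleFunctor.{u, u} R where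
  obj S _ _ := LinearMap.range (C.dual.p S)
  addCommGroup _ _ _ := inferInstance
  module _ _ _ := inferInstance
  map {S T _ _ _ _} f :=
    { toFun := fun a => ⟨fun k => f (a.1 k), by
        obtain ⟨w, hw⟩ := a.2
        exact ⟨X.dual.map f w, funext fun k => by rw [C.dual.p_map, hw]⟩⟩
      map_add' := fun a b => Subtype.ext (funext fun k => map_add f _ _)
      map_smul' := fun s a => Subtype.ext (funext fun k => _root_.map_mul f _ _) }
  map_id _ := rfl
  map_comp _ _ _ := rfl

/-- The isomorphism of `X^*` with `C.smallDual`. -/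
noncomputable def smallDualEquiv (S : Type u) [CommRing S] [Algebra R S] :
    X.dual.obj S ≃ₗ[S] C.smallDual.obj S :=
  LinearEquiv.ofInjective (C.dual.p S) (C.p_dual_injective S)

theorem smallDualEquiv_map (f : S →ₐ[R] T) (w : X.dual.obj S) :
    C.smallDualEquiv T (X.dual.map f w) = C.smallDual.map f (C.smallDualEquiv S w) :=
  Subtype.ext (funext fun k => C.dual.p_map f w k)

theorem smallDualEquiv_symm_map (f : S →ₐ[R] T) (a : C.smallDual.obj S) :
    (C.smallDualEquiv T).symm (C.smallDual.map f a) =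
      X.dual.map f ((C.smallDualEquiv S).symm a) := by
  rw [LinearEquiv.symm_apply_eq, smallDualEquiv_map, LinearEquiv.apply_symm_apply]

end CoordinateSystem

/-! ### Transposes and the universal property of the bidual. -/

/-- The transpose of a morphism. -/
def Hom.transpose {M : ModuleFunctor.{u, v} R} {N : ModuleFunctor.{u, v'} R} (f : Hom M N) :
    Hom N.dual M.dual where
  app S _ _ :=
    { toFun := fun (w : RestrictedHom N (structureFunctor R) S) =>
        (⟨fun T _ _ g => w.app T g ∘ₗ f.app T, fun g h m => by
          rw [LinearMap.comp_apply, f.naturality, w.naturality, LinearMap.comp_apply]⟩ :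
          RestrictedHom M (structureFunctor R) S)
      map_add' := fun _ _ => rfl
      map_smul' := fun _ _ => rfl }
  naturality _ _ := rfl

theorem Hom.pairing_transpose {M : ModuleFunctor.{u, v} R} {N : ModuleFunctor.{u, v'} R}
    (f : Hom M N) {S : Type u} [CommRing S] [Algebra R S] (w : N.dual.obj S) (m : M.obj S) :
    M.pairing S (f.transpose.app S w) m = N.pairing S w (f.app S m) := rfl

namespace CoordinateSystem
variable {K : Type u} {X : ModuleFunctor.{u, v} R} (C : CoordinateSystem K X)

/-- The only issue is size: X^{**} is the dual of X^*, whose values lie in a larger universe.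
Transposing the isomorphism with `C.smallDual` exhibits it as the dual of a functor valued in `u`.
-/
theorem isDual_dual_dual (C : CoordinateSystem K X) :
    IsDual.{u, max (u + 1) v, u} X.dual.dual := by
  let f : Hom C.smallDual X.dual :=
    { app := fun S _ _ => (C.smallDualEquiv S).symm.toLinearMap
      naturality := fun f a => C.smallDualEquiv_symm_map f a }
  let g : Hom X.dual C.smallDual :=
    { app := fun S _ _ => (C.smallDualEquiv S).toLinearMap
      naturality := fun f a => C.smallDualEquiv_map f a }
  have hfg : ∀ (S : Type u) [CommRing S] [Algebra R S] (a), g.app S (f.app S a) = a :=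
    fun S _ _ a => (C.smallDualEquiv S).apply_symm_apply a
  have hgf : ∀ (S : Type u) [CommRing S] [Algebra R S] (a), f.app S (g.app S a) = a :=
    fun S _ _ a => (C.smallDualEquiv S).symm_apply_apply a
  refine ⟨C.smallDual, f.transpose, fun S _ _ => Function.bijective_iff_has_inverse.2
    ⟨g.transpose.app S, fun w => dual_ext fun T _ _ h x => ?_,
      fun w => dual_ext fun T _ _ h x => ?_⟩⟩
  · rw [← Hom.naturality, ← Hom.naturality, Hom.pairing_transpose, Hom.pairing_transpose, hgf]
  · rw [← Hom.naturality, ← Hom.naturality, Hom.pairing_transpose, Hom.pairing_transpose, hfg]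

theorem inF_dual_dual (C : CoordinateSystem K X) : X.dual.dual.InF :=
  ⟨C.isDual_dual_dual, C.dual.exists_inclusions⟩

/-- The functionals on `X^{**}` are determined by their restrictions to `X`. -/
theorem dual_ext_toBidual (C : CoordinateSystem K X) {S : Type u} [CommRing S] [Algebra R S] {w w' : X.dual.dual.dual.obj S}
    (h : ∀ x : X.obj S, X.dual.dual.pairing S w (X.toBidual.app S x) =
      X.dual.dual.pairing S w' (X.toBidual.app S x)) : w = w' := by
  -- Evaluation at e_k and the k-th coordinate functional of X^* are the same element of X^{**}.
  have he : ∀ k, C.dual.dual.e S k = X.toBidual.app S (C.e S k) := fun k =>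
    C.dual.dual_ext_e fun l => by
      rw [pairing_toBidual]
      change X.dual.pairing S (C.dual.coord S k) _ = _
      rw [pairing_coord]
      rfl
  exact C.dual.dual.dual_ext_e fun k => by rw [he, h]

end CoordinateSystem

/-- The adjoint of a morphism `f : X → N^*`: the functional `x ↦ f(x)(n)`. -/
def Hom.adjoint {X : ModuleFunctor.{u, v} R} {N : ModuleFunctor.{u, w} R} (f : Hom X N.dual) :
    Hom N X.dual :=
  f.transpose.comp N.toBidual

theorem Hom.pairing_adjoint {X : ModuleFunctor.{u, v} R} {N : ModuleFunctor.{u, w} R}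
    (f : Hom X N.dual) {S : Type u} [CommRing S] [Algebra R S] (n : N.obj S) (x : X.obj S) :
    X.pairing S (f.adjoint.app S n) x = N.pairing S (f.app S x) n :=
  pairing_toBidual n _

/-- With M identified with N^*, existence is pure adjunction; the coordinate system enters only in
uniqueness. -/
theorem CoordinateSystem.bijective_comp_toBidual {K : Type u} {X : ModuleFunctor.{u, v} R}
    (C : CoordinateSystem K X) {M : ModuleFunctor.{u, v'} R} (hM : IsDual.{u, v', w} M) :
    Function.Bijective (fun f : Hom X.dual.dual M => f.comp X.toBidual) := by
  obtain ⟨N, θ, hθ⟩ := hM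
  have pairing_ext : ∀ {f f' : Hom X.dual.dual M},
      f.comp X.toBidual = f'.comp X.toBidual → f = f' := by
    intro f f' h
    refine Hom.ext ?_
    funext S _ _
    refine LinearMap.ext fun φ => (hθ S).1 ?_
    refine dual_ext fun T _ _ g n => ?_
    rw [← θ.naturality, ← θ.naturality, ← f.naturality, ← f'.naturality]
    -- For fixed n, φ ↦ f(φ)(n) is a functional on X^{**}, so agreement on the image of X suffices.
    have key : (θ.comp f).adjoint.app T n = (θ.comp f').adjoint.app T n :=
      C.dual_ext_toBidual fun x => by
        rw [Hom.pairing_adjoint, Hom.pairing_adjoint]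
        have hx : f.app T (X.toBidual.app T x) = f'.app T (X.toBidual.app T x) :=
          congrArg (fun F : Hom X M => F.app T x) h
        change N.pairing T (θ.app T (f.app T _)) n = N.pairing T (θ.app T (f'.app T _)) n
        rw [hx]
    have h' := congrArg (fun w => X.dual.dual.pairing T w (X.dual.dual.map g φ)) key
    simp only [Hom.pairing_adjoint] at h'
    exact h'
  refine ⟨fun f f' h => pairing_ext h, fun f => ?_⟩
  -- This sends φ to n ↦ φ(x ↦ f(x)(n)), with M read as N^* through `θ`.
  let F : Hom X.dual.dual N.dual := (θ.comp f).adjoint.transpose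
  let θe : ∀ (S : Type u) [CommRing S] [Algebra R S], M.obj S ≃ₗ[S] N.dual.obj S :=
    fun S _ _ => LinearEquiv.ofBijective (θ.app S) (hθ S)
  have hθe : ∀ (S : Type u) [CommRing S] [Algebra R S] (y : N.dual.obj S),
      θ.app S ((θe S).symm y) = y := fun S _ _ y => (θe S).apply_symm_apply y
  refine ⟨{ app := fun S _ _ => (θe S).symm.toLinearMap ∘ₗ F.app S
            naturality := fun {S T _ _ _ _} g φ => (hθ T).1 ?_ }, ?_⟩
  · change θ.app T ((θe T).symm _) = θ.app T (M.map g ((θe S).symm _))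
    rw [hθe, θ.naturality, hθe, F.naturality]
  · refine Hom.ext ?_
    funext S _ _
    refine LinearMap.ext fun x => (hθ S).1 ?_
    change θ.app S ((θe S).symm (F.app S (X.toBidual.app S x))) = θ.app S (f.app S x)
    rw [hθe]
    refine dual_ext fun T _ _ g n => ?_
    rw [← F.naturality, ← X.toBidual.naturality, ← θ.naturality, ← f.naturality,
      Hom.pairing_transpose, pairing_toBidual, Hom.pairing_adjoint]
    rfl

/-! ### Action of idempotents on a functor between ⊕_J 𝓡 and ∏_J 𝓡. -/

section Unit

variable {J : Type u} {M : ModuleFunctor.{u, v} R} {A : ProdModuleStructure J M}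
  {i : Hom (directSum R J) M} {p : Hom M (prod R J)} {S T : Type u} [CommRing S] [Algebra R S]
  [CommRing T] [Algebra R T]

/-- The coordinates given by a morphism `M → ∏_J 𝓡`. -/
def Hom.coeff (p : Hom M (prod R J)) (S : Type u) [CommRing S] [Algebra R S] :
    M.obj S →ₗ[S] (J → S) :=
  p.app S

theorem Hom.coeff_map (p : Hom M (prod R J)) (f : S →ₐ[R] T) (m : M.obj S) (j : J) :
    p.coeff T (M.map f m) j = f (p.coeff S m j) :=
  congrFun (p.naturality f m) j

theorem Hom.IsProdLinear.coeff (hpl : p.IsProdLinear A (prodStructure R J)) (a : J → S)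
    (m : M.obj S) : p.coeff S (A.act S a m) = a * p.coeff S m :=
  hpl S a m

/-- The image in `M` of the `j`-th element of the basis of `⊕_J 𝓡`. -/
noncomputable def Hom.unit (i : Hom (directSum R J) M) (S : Type u) [CommRing S] [Algebra R S]
    (j : J) : M.obj S :=
  i.app S (Finsupp.single j (1 : S) : J →₀ S)

theorem Hom.map_unit (i : Hom (directSum R J) M) (f : S →ₐ[R] T) (j : J) :
    M.map f (i.unit S j) = i.unit T j := by
  refine (i.naturality f _).symm.trans (congrArg (i.app T) ?_)
  refine (Finsupp.mapRange_single (f := f) (hf := map_zero f)).trans ?_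
  rw [map_one]

theorem Hom.coeff_unit [DecidableEq J] (hpi : p.comp i = directSumToProd R J) (j : J) :
    p.coeff S (i.unit S j) = Pi.single j 1 := by
  have h : p.coeff S (i.unit S j) = ((Finsupp.single j (1 : S) : J →₀ S) : J → S) :=
    congrArg (fun f : Hom (directSum R J) (prod R J) =>
      f.app S (Finsupp.single j (1 : S) : J →₀ S)) hpi
  rw [h, Finsupp.single_eq_pi_single]

/-- Since `p` is injective and ∏-linear, the identity can be checked in ∏_J S. -/
theorem ProdModuleStructure.act_single [DecidableEq J] (hp : p.IsInjective)
    (hpl : p.IsProdLinear A (prodStructure R J)) (hpi : p.comp i = directSumToProd R J)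
    (j : J) (m : M.obj S) :
    A.act S (Pi.single j 1) m = p.coeff S m j • i.unit S j := by
  refine hp S ?_
  change p.coeff S _ = p.coeff S _
  rw [hpl.coeff, map_smul, Hom.coeff_unit hpi]
  funext l
  rw [Pi.mul_apply, Pi.smul_apply, smul_eq_mul]
  by_cases h : l = j
  · subst h
    rw [mul_comm]
  · rw [Pi.single_eq_of_ne h, zero_mul, mul_zero]

theorem ProdModuleStructure.act_indicator [DecidableEq J] (hp : p.IsInjective)
    (hpl : p.IsProdLinear A (prodStructure R J)) (hpi : p.comp i = directSumToProd R J)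
    (V : Finset J) (m : M.obj S) :
    A.act S (fun j => if j ∈ V then 1 else 0) m = ∑ j ∈ V, p.coeff S m j • i.unit S j := by
  have h : (fun j => if j ∈ V then 1 else 0 : J → S) = ∑ j ∈ V, Pi.single j 1 := by
    funext l
    simp [Finset.sum_apply, Pi.single_apply]
  rw [h, map_sum, LinearMap.sum_apply]
  exact Finset.sum_congr rfl fun j _ => act_single hp hpl hpi j m

end Unit

/-! ### The coordinate system of a tensor product. -/

section Tensor

variable {J' J : Type u} {M' : ModuleFunctor.{u, v'} R} {M : ModuleFunctor.{u, v} R}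
  {A' : ProdModuleStructure J' M'} {A : ProdModuleStructure J M}
  {i' : Hom (directSum R J') M'} {i : Hom (directSum R J) M}
  {p' : Hom M' (prod R J')} {p : Hom M (prod R J)}

/-- The canonical bilinear map `M'(S) × M(S) → (M' ⊗ M)(S)`. -/
def tmul (M' : ModuleFunctor.{u, v'} R) (M : ModuleFunctor.{u, v} R)
    (S : Type u) [CommRing S] [Algebra R S] :
    M'.obj S →ₗ[S] M.obj S →ₗ[S] (M'.tensor M).obj S :=
  TensorProduct.mk S (M'.obj S) (M.obj S)

theorem map_tmul {S T : Type u} [CommRing S] [Algebra R S] [CommRing T] [Algebra R T]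
    (f : S →ₐ[R] T) (m' : M'.obj S) (m : M.obj S) :
    (M'.tensor M).map f (tmul M' M S m' m) = tmul M' M T (M'.map f m') (M.map f m) :=
  TensorProduct.map_tmul _ _ m' m

theorem tensor_induction {S : Type u} [CommRing S] [Algebra R S]
    {q : (M'.tensor M).obj S → Prop} (x : (M'.tensor M).obj S) (zero : q 0)
    (tmul : ∀ m' m, q (tmul M' M S m' m)) (add : ∀ x y, q x → q y → q (x + y)) : q x :=
  TensorProduct.induction_on x zero tmul add

/-- The coordinates on a tensor product. -/
noncomputable def tensorCoordinates (p' : Hom M' (prod R J')) (p : Hom M (prod R J))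
    (S : Type u) [CommRing S] [Algebra R S] : (M'.tensor M).obj S →ₗ[S] (J' × J → S) :=
  LinearMap.pi fun k => TensorProduct.lift ((LinearMap.mul S S).compl₁₂
    ((LinearMap.proj k.1 : (J' → S) →ₗ[S] S) ∘ₗ p'.coeff S)
    ((LinearMap.proj k.2 : (J → S) →ₗ[S] S) ∘ₗ p.coeff S))

theorem tensorCoordinates_tmul {S : Type u} [CommRing S] [Algebra R S]
    (m' : M'.obj S) (m : M.obj S) (k : J' × J) :
    tensorCoordinates p' p S (tmul M' M S m' m) k =
      p'.coeff S m' k.1 * p.coeff S m k.2 :=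
  rfl

theorem tensorCoordinates_map {S T : Type u} [CommRing S] [Algebra R S] [CommRing T] [Algebra R T]
    (f : S →ₐ[R] T) (x : (M'.tensor M).obj S) (k : J' × J) :
    tensorCoordinates p' p T ((M'.tensor M).map f x) k = f (tensorCoordinates p' p S x k) := by
  induction x using tensor_induction with
  | zero => simp only [map_zero, Pi.zero_apply]
  | tmul m' m =>
    rw [map_tmul, tensorCoordinates_tmul, tensorCoordinates_tmul, Hom.coeff_map, Hom.coeff_map,
      map_mul]
  | add x y hx hy => simp only [map_add, Pi.add_apply, hx, hy]

/-- The map (a', a) ↦ w(a'm' ⊗ am) is natural on ∏_{J' ⊕ J} 𝓡, so finitely many coordinates of a'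
and of a matter. Idempotents cut m' and m down to finite combinations of unit vectors, and
bilinearity expands the result. -/
theorem exists_finset_pairing_tmul (hp' : p'.IsInjective)
    (hpl' : p'.IsProdLinear A' (prodStructure R J')) (hpi' : p'.comp i' = directSumToProd R J')
    (hp : p.IsInjective) (hpl : p.IsProdLinear A (prodStructure R J))
    (hpi : p.comp i = directSumToProd R J)
    {S : Type u} [CommRing S] [Algebra R S] (w : (M'.tensor M).dual.obj S)
    (m' : M'.obj S) (m : M.obj S) :
    ∃ V : Finset (J' × J),
      (∀ k ∉ V, p'.coeff S m' k.1 * p.coeff S m k.2 *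
        (M'.tensor M).pairing S w (tmul M' M S (i'.unit S k.1) (i.unit S k.2)) = 0) ∧
      (M'.tensor M).pairing S w (tmul M' M S m' m) =
        ∑ k ∈ V, p'.coeff S m' k.1 * p.coeff S m k.2 *
          (M'.tensor M).pairing S w (tmul M' M S (i'.unit S k.1) (i.unit S k.2)) := by
  classical
  obtain ⟨V, hV⟩ := exists_finset_congr (R := R) (S := S) (K := J' ⊕ J)
    (fun T _ _ g a => (M'.tensor M).pairing T ((M'.tensor M).dual.map g w)
      (tmul M' M T (A'.act T (fun j => a (Sum.inl j)) (M'.map g m'))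
        (A.act T (fun j => a (Sum.inr j)) (M.map g m))))
    (fun {T T' _ _ _ _} g h a => by
      rw [(M'.tensor M).dual.map_comp, M'.map_comp, M.map_comp, ← A'.map_act h, ← A.map_act h,
        ← map_tmul, pairing_map])
  let B : M'.obj S →ₗ[S] M.obj S →ₗ[S] S :=
    (tmul M' M S).compr₂ ((M'.tensor M).pairing S w)
  replace hV : ∀ (a' b' : J' → S) (a b : J → S), (∀ j ∈ V.toLeft, a' j = b' j) →
      (∀ j ∈ V.toRight, a j = b j) →
      B (A'.act S a' m') (A.act S a m) = B (A'.act S b' m') (A.act S b m) := by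
    intro a' b' a b h' h
    have hs := hV S (AlgHom.id R S) (Sum.elim a' a) (Sum.elim b' b) (by
      rintro (j | j) hj
      · exact h' j (Finset.mem_toLeft.2 hj)
      · exact h j (Finset.mem_toRight.2 hj))
    rw [(M'.tensor M).dual.map_id, M'.map_id, M.map_id] at hs
    exact hs
  have hB : ∀ (j' : J') (j : J), B (A'.act S (Pi.single j' 1) m') (A.act S (Pi.single j 1) m) =
      p'.coeff S m' j' * p.coeff S m j * B (i'.unit S j') (i.unit S j) := by
    intro j' j
    rw [A'.act_single hp' hpl' hpi', A.act_single hp hpl hpi, map_smul B, LinearMap.smul_apply,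
      map_smul, smul_eq_mul, smul_eq_mul, mul_assoc]
  refine ⟨V.toLeft ×ˢ V.toRight, fun k hk => ?_, ?_⟩
  · refine (hB k.1 k.2).symm.trans ?_
    -- A pair outside the product has a component outside its finite set; the idempotent at that
    -- component may be replaced by 0, killing the term.
    rw [Finset.mem_product, not_and_or] at hk
    rcases hk with hk | hk
    · rw [hV _ 0 _ (Pi.single k.2 1)
        (fun l hl => Pi.single_eq_of_ne (ne_of_mem_of_not_mem hl hk) 1) fun _ _ => rfl,
        map_zero, LinearMap.zero_apply, map_zero, LinearMap.zero_apply]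
    · rw [hV _ (Pi.single k.1 1) _ 0 (fun _ _ => rfl)
        fun l hl => Pi.single_eq_of_ne (ne_of_mem_of_not_mem hl hk) 1,
        map_zero, LinearMap.zero_apply, map_zero]
  -- Replacing 1 by the two indicator families leaves the value of w unchanged and makes both
  -- factors finite sums.
  · have h := hV 1 (fun j => if j ∈ V.toLeft then 1 else 0) 1
      (fun j => if j ∈ V.toRight then 1 else 0) (fun j hj => by simp only [hj, if_true]; rfl)
      (fun j hj => by simp only [hj, if_true]; rfl)
    rw [map_one, map_one, A'.act_indicator hp' hpl' hpi', A.act_indicator hp hpl hpi, map_sum B,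
      LinearMap.sum_apply] at h
    refine h.trans ?_
    rw [Finset.sum_product]
    refine Finset.sum_congr rfl fun j' _ => ?_
    rw [map_sum]
    refine Finset.sum_congr rfl fun j _ => ?_
    rw [map_smul B, LinearMap.smul_apply, map_smul, smul_eq_mul, smul_eq_mul, mul_assoc]
    rfl

/-- Finiteness is proved together with the formula because additivity of `finsum` needs finite
supports in the induction on tensors. -/
theorem finite_support_and_pairing_eq (hp' : p'.IsInjective)
    (hpl' : p'.IsProdLinear A' (prodStructure R J')) (hpi' : p'.comp i' = directSumToProd R J')
    (hp : p.IsInjective) (hpl : p.IsProdLinear A (prodStructure R J))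
    (hpi : p.comp i = directSumToProd R J)
    {S : Type u} [CommRing S] [Algebra R S] (w : (M'.tensor M).dual.obj S)
    (x : (M'.tensor M).obj S) :
    (Function.support fun k => tensorCoordinates p' p S x k *
      (M'.tensor M).pairing S w (tmul M' M S (i'.unit S k.1) (i.unit S k.2))).Finite ∧
    (M'.tensor M).pairing S w x = ∑ᶠ k, tensorCoordinates p' p S x k *
      (M'.tensor M).pairing S w (tmul M' M S (i'.unit S k.1) (i.unit S k.2)) := by
  induction x using tensor_induction with
  | zero => simp
  | tmul m' m =>
    obtain ⟨V, hV, h⟩ := exists_finset_pairing_tmul hp' hpl' hpi' hp hpl hpi w m' m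
    simp only [tensorCoordinates_tmul]
    have hs : (Function.support fun k : J' × J => p'.coeff S m' k.1 * p.coeff S m k.2 *
        (M'.tensor M).pairing S w (tmul M' M S (i'.unit S k.1) (i.unit S k.2))) ⊆ V :=
      fun k hk => by_contra fun hkV => hk (hV k hkV)
    exact ⟨V.finite_toSet.subset hs, h.trans (finsum_eq_sum_of_support_subset _ hs).symm⟩
  | add x y hx hy =>
    simp only [map_add, Pi.add_apply, add_mul]
    refine ⟨(hx.1.union hy.1).subset (Function.support_add _ _), ?_⟩
    rw [hx.2, hy.2, finsum_add_distrib hx.1 hy.1]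

/-- The coordinate system on the tensor product of two functors of modules between a direct sum
and a direct product. -/
noncomputable def tensorCoordinateSystem (hp' : p'.IsInjective)
    (hpl' : p'.IsProdLinear A' (prodStructure R J')) (hpi' : p'.comp i' = directSumToProd R J')
    (hp : p.IsInjective) (hpl : p.IsProdLinear A (prodStructure R J))
    (hpi : p.comp i = directSumToProd R J) : CoordinateSystem (J' × J) (M'.tensor M) where
  e S _ _ k := tmul M' M S (i'.unit S k.1) (i.unit S k.2)
  map_e f k := by rw [map_tmul, Hom.map_unit, Hom.map_unit]
  p S _ _ := tensorCoordinates p' p S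
  p_map f x k := tensorCoordinates_map f x k
  p_e_self S _ _ k := by
    classical
    rw [tensorCoordinates_tmul, Hom.coeff_unit hpi', Hom.coeff_unit hpi, Pi.single_eq_same,
      Pi.single_eq_same, one_mul]
  p_e_ne S _ _ k l h := by
    classical
    rw [tensorCoordinates_tmul, Hom.coeff_unit hpi', Hom.coeff_unit hpi]
    by_cases h1 : l.1 = k.1
    · have h2 : l.2 ≠ k.2 := fun h2 => h (Prod.ext h1 h2).symm
      rw [Pi.single_eq_of_ne h2, mul_zero]
    · rw [Pi.single_eq_of_ne h1, zero_mul]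
  finite_support _ _ _ w x := (finite_support_and_pairing_eq hp' hpl' hpi' hp hpl hpi w x).1
  pairing_eq _ _ _ w x := (finite_support_and_pairing_eq hp' hpl' hpi' hp hpl hpi w x).2

end Tensor

theorem IsReflexive.isDual {M : ModuleFunctor.{u, v} R} (hM : M.IsReflexive) :
    IsDual.{u, v, max (u + 1) v} M :=
  ⟨M.dual, M.toBidual, hM⟩

end ModuleFunctor

theorem mainTheorem8 {R : Type u} [CommRing R]
    (M : ModuleFunctor.{u, v} R) (M' : ModuleFunctor.{u, v'} R)
    (hM : M.InF) (hM' : M'.InF) :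
    (M'.tensor M).dual.dual.InF ∧
    (∀ M'' : ModuleFunctor.{u, v''} R, ModuleFunctor.IsDual.{u, v'', w} M'' →
      Function.Bijective
        (fun f : ModuleFunctor.Hom (M'.tensor M).dual.dual M'' =>
          f.comp (M'.tensor M).toBidual)) ∧
    (∀ M'' : ModuleFunctor.{u, v''} R, M''.IsReflexive →
      Function.Bijective
        (fun f : ModuleFunctor.Hom (M'.tensor M).dual.dual M'' =>
          f.comp (M'.tensor M).toBidual)) := by
  obtain ⟨-, J, A, i, p, -, -, hp, hpl, hpi⟩ := hM
  obtain ⟨-, J', A', i', p', -, -, hp', hpl', hpi'⟩ := hM'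
  have C := ModuleFunctor.tensorCoordinateSystem hp' hpl' hpi' hp hpl hpi
  exact ⟨C.inF_dual_dual, fun _ h => C.bijective_comp_toBidual h,
    fun _ h => C.bijective_comp_toBidual h.isDual⟩
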